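/- **Theorem 1.5.** Let $X$ be a simplicial complex on a finite vertex set $V$ with $|V|=n$: a family of subsets (faces) of $V$ that contains every singleton and every subset of each of its members (in particular the empty face). Fix a linear order on $V$. Write $X(k)$ for the set of faces with $k+1$ vertices ($k\ge -1$) and $f_k(X)=|X(k)|$. For $\sigma\in X(k-1)$ and $\tau\in X(k)$ let $\partial_k(X)_{\sigma,\tau}=(-1)^{|\{v\in\tau:\,v<u\}|}$ if $\sigma\subset\tau$ and $\tau\setminus\sigma=\{u\}$, and $\partial_k(X)_{\sigma,\tau}=0$ otherwise; the $k$-dimensional combinatorial Laplacian is the matrix $$L_k(X)=\partial_{k+1}(X)\,\partial_{k+1}(X)^T+\partial_k(X)^T\,\partial_k(X)\in\mathbb R^{X(k)\times X(k)}.$$ Let $G_X$ be the $1$-skeleton of $X$, viewed as a graph on $V$, let $L(G_X)$ be its graph Laplacian (degree matrix minus adjacency matrix), and let $J\in\mathbb R^{V\times V}$ be the all-ones matrix. For a real $m\times m$ matrix $M$ with real eigenvalues let $\lambda_i(M)$ be its $i$-th smallest eigenvalue, counted with multiplicity, and let $S_{k,i}(M)$ be the $i$-th smallest element of the multiset $\bigl\{\sum_{j\in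 A}\lambda_j(M) : A\subseteq\{1,\dots,m\},\ |A|=k\bigr\}$. For $\sigma\in X$ let $\operatorname{lk}_X(\sigma)=\{\tau\in X:\sigma\cup\tau\in X,\ \sigma\cap\tau=\emptyset\}$, and write $u\in\operatorname{lk}_X(\sigma)$ for $\{u\}\in\operatorname{lk}_X(\sigma)$ and $\operatorname{lk}_X(v)$ for $\operatorname{lk}_X(\{v\})$. For $\sigma\in X(k)$ and $0\le j\le k+1$ put $$\sigma[j]=\bigl\{u\in V:\ u\notin\operatorname{lk}_X(\sigma),\ u\in\operatorname{lk}_X(v)\text{ for all }v\in\sigma,\ |\{w\in\sigma: u\in\operatorname{lk}_X(\sigma\setminus\{w\})\}|=j\bigr\}.$$ Then for all integers $k\ge 0$ and $1\le i\le f_k(X)$, $$\lambda_i(L_k(X))\ \ge\ S_{k+1,i}\bigl(L(G_X)+J\bigr)-kn-\max_{\sigma\in X(k)}\sum_{j=0}^{k+1}(j+1)\,\bigl|\sigma[j]\bigr|.$$ -/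

import Mathlib

open Finset
open scoped Matrix

noncomputable section

namespace SimplicialLaplacian

/-- The `i`-th smallest element (counted from `1`, with multiplicity) of a finite multiset of reals,
for `1 ≤ i ≤ s.card`. -/
def nthSmallest (s : Multiset ℝ) (i : ℕ) : ℝ := (s.sort (· ≤ ·)).getD (i - 1) 0

/-- `λ_i(M)`: the `i`-th smallest eigenvalue of a real matrix with real eigenvalues, where
eigenvalues are counted with (algebraic) multiplicity, `1 ≤ i ≤ |ι|`. -/
def eig {ι : Type*} [Fintype ι] [DecidableEq ι] (M : Matrix ι ι ℝ) (i : ℕ) : ℝ :=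
  nthSmallest M.charpoly.roots i

/-- `S_{k,i}(M)`: the `i`-th smallest element of the multiset of all sums `∑_{j ∈ A} λ_j(M)`,
where `A` runs over the `k`-element subsets of `[n] = {1, …, n}` and `n` is the size of `M`. -/
def eigSum {ι : Type*} [Fintype ι] [DecidableEq ι] (M : Matrix ι ι ℝ) (k i : ℕ) : ℝ :=
  nthSmallest
    (((Finset.Icc 1 (Fintype.card ι)).powersetCard k).val.map fun A => ∑ j ∈ A, eig M j) i

section Complex

variable {V : Type*} [LinearOrder V]

/-- Faces of `X`, the empty face included (Mathlib's complexes list the nonempty faces only). -/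
def IsFace (X : AbstractSimplicialComplex V) (σ : Finset V) : Prop := σ = ∅ ∨ σ ∈ X.faces

/-- The link `lk_X(σ)`. -/
def link (X : AbstractSimplicialComplex V) (σ : Finset V) : Set (Finset V) :=
  {τ | IsFace X τ ∧ IsFace X (σ ∪ τ) ∧ σ ∩ τ = ∅}

/-- The `1`-skeleton `G_X`, as a graph on the vertex set. -/
def graph (X : AbstractSimplicialComplex V) : SimpleGraph V where
  Adj u v := u ≠ v ∧ IsFace X {u, v}
  symm := ⟨fun u v h => ⟨h.1.symm, by rw [Finset.pair_comm]; exact h.2⟩⟩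
  loopless := ⟨fun _ h => h.1 rfl⟩

/-- The incidence sign `(τ : σ) = (-1)^{|{v ∈ τ | v < u}|}` with `{u} = τ \ σ`, extended by `0` to
`σ ⊄ τ`; used for `|τ| = |σ| + 1`, so that the sum has exactly one term when `σ ⊆ τ`. -/
def incidence (τ σ : Finset V) : ℝ :=
  if σ ⊆ τ then ∑ u ∈ τ \ σ, (-1 : ℝ) ^ #{v ∈ τ | v < u} else 0

variable [Fintype V]

open scoped Classical in
/-- The faces of `X` with exactly `m` vertices; `X(k) = facesOfCard X (k + 1)` is the set of
`k`-dimensional faces, for `k ≥ -1`. -/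
def facesOfCard (X : AbstractSimplicialComplex V) (m : ℕ) : Finset (Finset V) :=
  {σ | IsFace X σ ∧ #σ = m}

/-- The real boundary matrix `∂_k(X)`, with rows `X(k-1)` and columns `X(k)`. -/
def boundary (X : AbstractSimplicialComplex V) (k : ℕ) :
    Matrix (facesOfCard X k) (facesOfCard X (k + 1)) ℝ :=
  Matrix.of fun σ τ => incidence (τ : Finset V) (σ : Finset V)

/-- The combinatorial Laplacian `L_k(X) = ∂_{k+1} ∂_{k+1}ᵀ + ∂_kᵀ ∂_k`. -/
def laplacian (X : AbstractSimplicialComplex V) (k : ℕ) :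
    Matrix (facesOfCard X (k + 1)) (facesOfCard X (k + 1)) ℝ :=
  boundary X (k + 1) * (boundary X (k + 1))ᵀ + (boundary X k)ᵀ * boundary X k

open scoped Classical in
/-- The matrix `L(G_X) + J`, with `L` the graph Laplacian and `J` the all-ones matrix. -/
def graphLaplacianAddJ (X : AbstractSimplicialComplex V) : Matrix V V ℝ :=
  (graph X).lapMatrix ℝ + Matrix.of fun _ _ => 1

open scoped Classical in
/-- The set `σ[j]` of the vertices `u` outside `lk_X(σ)` which lie in `lk_X(v)` for every `v ∈ σ`,
and in `lk_X(σ \ {w})` for exactly `j` vertices `w ∈ σ`. -/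
def defect (X : AbstractSimplicialComplex V) (σ : Finset V) (j : ℕ) : Finset V :=
  {u | {u} ∉ link X σ ∧ (∀ v ∈ σ, {u} ∈ link X {v}) ∧
    #{w ∈ σ | {u} ∈ link X (σ \ {w})} = j}

end Complex

end SimplicialLaplacian

end

open SimplicialLaplacian

noncomputable section

namespace SimplicialLaplacian

/-! Functions on `Finset V` form the exterior algebra of `ℝ^V`; `creation u` and `annihilation u`
are the wedge and the contraction with a basis vector. If a symmetric `M` has orthonormal
eigenvectors `v_a` with eigenvalues `λ_a`, then `∑ M_{uv} a_u† a_v` is diagonalized by the wedge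
products of the `v_a`, `a ∈ A`, with eigenvalues `∑_{a ∈ A} λ_a` (`exists_eigenbasis_derivation`).
For `M = L(G_X) + J` and `|A| = k + 1` these are the sums behind `S_{k+1,i}`. Extension by zero
embeds `ℝ^{X(k)}` isometrically, so an inequality of quadratic forms (`derivation_form_add_le`)
gives the theorem by Courant–Fischer (`nthSmallest_add_le_nthSmallest`).

On functions supported on `X(k)`, the lower Laplacian has exactly the form of the `J` part. In the
upper one, anticommutation turns the terms with `u ≠ v` into `-(a_u f)(π) (a_v f)(π)`, summed over
the `π` with `π ∪ {u, v}` a face; the form of `L(G_X)` has the same terms whenever `uv` is an edge.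
The surplus, over edges `uv` with `π ∪ {u, v}` not a face, is bounded by `ab ≥ -(a² + b²)/2`. Only
diagonal terms remain, and these are counted vertex by vertex (`card_adj_add_card_isBad_le`). -/

/-! ### Order statistics and the Courant–Fischer comparison -/

/-- This and the next bound are the dimension counts for Courant–Fischer. The strict inequalities
make them valid in the presence of ties. -/
theorem card_filter_lt_nthSmallest {s : Multiset ℝ} {i : ℕ} (hi : 1 ≤ i) (his : i ≤ s.card) :
    (s.filter (· < nthSmallest s i)).card + 1 ≤ i := by
  set c := nthSmallest s i with hc
  set l := s.sort (· ≤ ·) with hl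
  have hlen : l.length = s.card := Multiset.length_sort _
  have hs : (l : Multiset ℝ) = s := Multiset.sort_eq s _
  have hsorted : l.Pairwise (· ≤ ·) := Multiset.pairwise_sort s _
  have hlt : i - 1 < l.length := by omega
  have hcl : c = l[i - 1] := by
    rw [hc, nthSmallest, ← hl, List.getD_eq_getElem _ _ hlt]
  have hdrop : (l.drop (i - 1)).filter (· < c) = [] := by
    rw [List.filter_eq_nil_iff]
    intro a ha
    obtain ⟨j, hj, rfl⟩ := List.mem_iff_getElem.1 ha
    simp only [List.getElem_drop, decide_eq_true_eq, not_lt, hcl]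
    rcases Nat.eq_zero_or_pos j with rfl | hj0
    · simp
    · exact List.pairwise_iff_getElem.1 hsorted _ _ _ _ (by omega)
  rw [← hs, Multiset.filter_coe, Multiset.coe_card, ← List.take_append_drop (i - 1) l,
    List.filter_append, hdrop, List.append_nil]
  have := (List.length_filter_le (· < c) (l.take (i - 1))).trans (List.length_take_le _ _)
  omega

theorem card_filter_nthSmallest_lt {s : Multiset ℝ} {i : ℕ} (hi : 1 ≤ i) (his : i ≤ s.card) :
    (s.filter (nthSmallest s i < ·)).card + i ≤ s.card := by
  set c := nthSmallest s i with hc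
  set l := s.sort (· ≤ ·) with hl
  have hlen : l.length = s.card := Multiset.length_sort _
  have hs : (l : Multiset ℝ) = s := Multiset.sort_eq s _
  have hsorted : l.Pairwise (· ≤ ·) := Multiset.pairwise_sort s _
  have hlt : i - 1 < l.length := by omega
  have hcl : c = l[i - 1] := by
    rw [hc, nthSmallest, ← hl, List.getD_eq_getElem _ _ hlt]
  have htake : (l.take i).filter (c < ·) = [] := by
    rw [List.filter_eq_nil_iff]
    intro a ha
    obtain ⟨j, hj, rfl⟩ := List.mem_iff_getElem.1 ha
    rw [List.length_take] at hj
    simp only [List.getElem_take, decide_eq_true_eq, not_lt, hcl]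
    rcases (show j ≤ i - 1 by omega).eq_or_lt with rfl | hj0
    · exact le_rfl
    · exact List.pairwise_iff_getElem.1 hsorted _ _ _ _ hj0
  have h1 : (s.filter (c < ·)).card = ((l.drop i).filter (c < ·)).length := by
    rw [← hs, Multiset.filter_coe, Multiset.coe_card]
    conv_lhs => rw [← List.take_append_drop i l, List.filter_append, htake, List.nil_append]
  have h2 := List.length_filter_le (c < ·) (l.drop i)
  rw [List.length_drop] at h2
  omega

/-- Parseval's identity for a complete orthonormal family. -/
theorem dotProduct_eq_sum_of_orthonormal {α κ : Type*} [Fintype α] [Fintype κ] [DecidableEq κ]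
    (hcard : Fintype.card κ = Fintype.card α) {w : κ → α → ℝ}
    (hw : ∀ A B, w A ⬝ᵥ w B = if A = B then 1 else 0) (f g : α → ℝ) :
    f ⬝ᵥ g = ∑ A, (w A ⬝ᵥ f) * (w A ⬝ᵥ g) := by
  classical
  let W : Matrix κ α ℝ := Matrix.of w
  have h1 : W * Wᵀ = 1 := by
    ext A B
    rw [Matrix.mul_apply', Matrix.one_apply]
    exact hw A B
  -- Equal cardinalities make the one-sided inverse two-sided: this is completeness of the family.
  have h2 : Wᵀ * W = 1 := (Matrix.mul_eq_one_comm_of_card_eq _ _ _ hcard).1 h1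
  calc f ⬝ᵥ g = f ⬝ᵥ ((Wᵀ * W) *ᵥ g) := by rw [h2, Matrix.one_mulVec]
    _ = (W *ᵥ f) ⬝ᵥ (W *ᵥ g) := by
      rw [← Matrix.mulVec_mulVec, Matrix.dotProduct_mulVec, Matrix.vecMul_transpose]
    _ = _ := rfl

/-- Courant–Fischer comparison of two diagonalized quadratic forms along an isometric embedding,
the range of which only meets the eigenvectors in `K`. -/
theorem nthSmallest_add_le_nthSmallest {α β ι κ : Type*} [Fintype α] [Fintype β] [Fintype ι]
    [Fintype κ] [DecidableEq ι] [DecidableEq κ]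
    (hια : Fintype.card ι = Fintype.card α) (hκβ : Fintype.card κ = Fintype.card β)
    {v : ι → α → ℝ} (hv : ∀ a b, v a ⬝ᵥ v b = if a = b then 1 else 0)
    {w : κ → β → ℝ} (hw : ∀ a b, w a ⬝ᵥ w b = if a = b then 1 else 0)
    (P : (α → ℝ) →ₗ[ℝ] (β → ℝ)) (hP : ∀ x, P x ⬝ᵥ P x = x ⬝ᵥ x)
    (K : Finset κ) (hK : ∀ A ∉ K, ∀ x, w A ⬝ᵥ P x = 0) (l : ι → ℝ) (m : κ → ℝ) (c : ℝ)
    (hform : ∀ x, ∑ A, m A * (w A ⬝ᵥ P x) ^ 2 + c * (x ⬝ᵥ x) ≤ ∑ a, l a * (v a ⬝ᵥ x) ^ 2)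
    {i : ℕ} (hi : 1 ≤ i) (hiι : i ≤ Fintype.card ι) (hiK : i ≤ #K) :
    nthSmallest (K.val.map m) i + c ≤ nthSmallest ((univ : Finset ι).val.map l) i := by
  set M := nthSmallest (K.val.map m) i with hM
  set Λ := nthSmallest ((univ : Finset ι).val.map l) i with hΛ
  have h1 : #{A ∈ K | m A < M} + 1 ≤ i := by
    have := card_filter_lt_nthSmallest (s := K.val.map m) hi (by simpa using hiK)
    rwa [Multiset.filter_map, Multiset.card_map] at this
  have h2 : #{a : ι | Λ < l a} + i ≤ Fintype.card ι := by
    have := card_filter_nthSmallest_lt (s := (univ : Finset ι).val.map l) hi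
      (by simpa using hiι)
    rwa [Multiset.filter_map, Multiset.card_map, Multiset.card_map] at this
  -- The conditions in `T` number at most `(card ι - i) + (i - 1) < card α`, so some nonzero `x`
  -- avoids both the large `l a` and the small `m A`.
  let T : (α → ℝ) →ₗ[ℝ]
      ({a // a ∈ ({a : ι | Λ < l a} : Finset ι)} → ℝ) × ({A // A ∈ {A ∈ K | m A < M}} → ℝ) :=
    LinearMap.prod (LinearMap.pi fun a => dotProductBilin ℝ ℝ (v a))
      (LinearMap.pi fun A => (dotProductBilin ℝ ℝ (w A)) ∘ₗ P)
  obtain ⟨x, hx, hx0⟩ : ∃ x ∈ LinearMap.ker T, x ≠ 0 := by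
    refine (LinearMap.ker T).ne_bot_iff.1 (LinearMap.ker_ne_bot_of_finrank_lt ?_)
    rw [Module.finrank_prod, Module.finrank_fintype_fun_eq_card, Module.finrank_fintype_fun_eq_card,
      Module.finrank_fintype_fun_eq_card, Fintype.card_coe, Fintype.card_coe, ← hια]
    omega
  have hT : T x = 0 := hx
  have hx1 : ∀ a, Λ < l a → v a ⬝ᵥ x = 0 := fun a ha =>
    congrFun (congrArg Prod.fst hT) ⟨a, by simpa using ha⟩
  have hx2 : ∀ A ∈ K, m A < M → w A ⬝ᵥ P x = 0 := fun A hA hAM =>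
    congrFun (congrArg Prod.snd hT) ⟨A, by simp [hA, hAM]⟩
  have hpos : 0 < x ⬝ᵥ x :=
    lt_of_le_of_ne (Finset.sum_nonneg fun j _ => mul_self_nonneg (x j))
      (fun h => hx0 (dotProduct_self_eq_zero.1 h.symm))
  have hup : ∑ a, l a * (v a ⬝ᵥ x) ^ 2 ≤ Λ * (x ⬝ᵥ x) := by
    rw [dotProduct_eq_sum_of_orthonormal hια hv x x, mul_sum]
    refine sum_le_sum fun a _ => ?_
    by_cases ha : Λ < l a
    · simp [hx1 a ha]
    · rw [← sq]
      exact mul_le_mul_of_nonneg_right (not_lt.1 ha) (sq_nonneg _)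
  have hlow : M * (x ⬝ᵥ x) ≤ ∑ A, m A * (w A ⬝ᵥ P x) ^ 2 := by
    rw [← hP x, dotProduct_eq_sum_of_orthonormal hκβ hw (P x) (P x), mul_sum]
    refine sum_le_sum fun A _ => ?_
    by_cases hA : A ∈ K
    · by_cases hAM : m A < M
      · simp [hx2 A hA hAM]
      · rw [← sq]
        exact mul_le_mul_of_nonneg_right (not_lt.1 hAM) (sq_nonneg _)
    · simp [hK A hA]
  have := hform x
  nlinarith

/-! ### Orthonormal eigenbases, enumerated in increasing order -/

theorem roots_charpoly_eq_map_eigenvalues {ι : Type*} [Fintype ι] [DecidableEq ι]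
    {M : Matrix ι ι ℝ} (hM : M.IsHermitian) :
    M.charpoly.roots = (univ : Finset ι).val.map hM.eigenvalues := by
  rw [hM.roots_charpoly_eq_eigenvalues]
  rfl

theorem exists_orthonormal_eigenvectors {ι : Type*} [Fintype ι] [DecidableEq ι]
    {M : Matrix ι ι ℝ} (hM : M.IsHermitian) :
    ∃ v : ι → ι → ℝ, (∀ a b, v a ⬝ᵥ v b = if a = b then 1 else 0) ∧
      ∀ a, M *ᵥ v a = hM.eigenvalues a • v a := by
  refine ⟨fun a => hM.eigenvectorBasis a, fun a b => ?_, fun a => hM.mulVec_eigenvectorBasis a⟩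
  have := orthonormal_iff_ite.1 hM.eigenvectorBasis.orthonormal b a
  rw [EuclideanSpace.inner_eq_star_dotProduct] at this
  simpa [eq_comm] using this

/-- The quadratic form of a symmetric matrix in an orthonormal eigenbasis. -/
theorem dotProduct_mulVec_eq_sum {ι : Type*} [Fintype ι] [DecidableEq ι]
    {M : Matrix ι ι ℝ} (hM : M.IsHermitian) {v : ι → ι → ℝ} {l : ι → ℝ}
    (hv : ∀ a b, v a ⬝ᵥ v b = if a = b then 1 else 0) (hMv : ∀ a, M *ᵥ v a = l a • v a)
    (x : ι → ℝ) : x ⬝ᵥ (M *ᵥ x) = ∑ a, l a * (v a ⬝ᵥ x) ^ 2 := by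
  rw [dotProduct_eq_sum_of_orthonormal rfl hv]
  refine sum_congr rfl fun a _ => ?_
  have hT : Mᵀ = M := hM
  rw [Matrix.dotProduct_mulVec, ← Matrix.mulVec_transpose, hT, hMv, smul_dotProduct, smul_eq_mul]
  ring

/-- The sorted roots and `hM.eigenvalues` agree as multisets, so a bijection matching their fibres
reindexes the eigenbasis. The shift `a + 1` is there because `eig` counts from `1`. -/
theorem exists_enumerated_eigenvectors {ι : Type*} [Fintype ι] [DecidableEq ι] {n : ℕ}
    (hn : Fintype.card ι = n) {M : Matrix ι ι ℝ} (hM : M.IsHermitian) :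
    ∃ v : Fin n → ι → ℝ, (∀ a b, v a ⬝ᵥ v b = if a = b then 1 else 0) ∧
      ∀ a : Fin n, M *ᵥ v a = eig M (a + 1) • v a := by
  obtain ⟨v, hv, hMv⟩ := exists_orthonormal_eigenvectors hM
  have hroots := roots_charpoly_eq_map_eigenvalues hM
  set l := M.charpoly.roots.sort (· ≤ ·) with hl
  have hlen : l.length = n := by
    rw [hl, Multiset.length_sort, hroots, Multiset.card_map, ← hn]; rfl
  have hofFn : l = List.ofFn fun a : Fin n => eig M (a + 1) := by
    refine List.ext_getElem (by simp [hlen]) fun j h1 h2 => ?_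
    simp [eig, nthSmallest, ← hl, List.getElem?_eq_getElem h1]
  have hmap : (univ : Finset (Fin n)).val.map (fun a : Fin n => eig M (a + 1)) =
      (univ : Finset ι).val.map hM.eigenvalues := by
    rw [← hroots, Fin.univ_val_map, ← hofFn, hl, Multiset.sort_eq]
  obtain ⟨e, he⟩ : ∃ e : Fin n ≃ ι, ∀ a, hM.eigenvalues (e a) = eig M (a + 1) := by
    have hcount : ∀ x : ℝ, Fintype.card {a : Fin n // eig M (a + 1) = x} =
        Fintype.card {a : ι // hM.eigenvalues a = x} := by
      intro x
      have := congrArg (Multiset.count x) hmap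
      rw [Multiset.count_map, Multiset.count_map] at this
      rw [Fintype.card_subtype, Fintype.card_subtype]
      simpa [Finset.card, eq_comm] using this
    refine ⟨Equiv.ofFiberEquiv (f := fun a : Fin n => eig M (a + 1)) (g := hM.eigenvalues)
      fun x => Fintype.equivOfCardEq (hcount x), fun a => ?_⟩
    exact Equiv.ofFiberEquiv_map _ a
  refine ⟨fun a => v (e a), fun a b => ?_, fun a => ?_⟩
  · rw [hv]; simp
  · rw [hMv, he]

theorem eigSum_eq_nthSmallest {ι : Type*} [Fintype ι] [DecidableEq ι] {n : ℕ}
    (hn : Fintype.card ι = n) (M : Matrix ι ι ℝ) (k i : ℕ) :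
    eigSum M k i = nthSmallest (((univ : Finset (Fin n)).powersetCard k).val.map
      fun A : Finset (Fin n) => ∑ j ∈ A, eig M (j + 1)) i := by
  have hinj : Function.Injective fun a : Fin n => (a : ℕ) + 1 :=
    fun a b h => Fin.ext (Nat.succ.inj h)
  have h : Finset.Icc 1 (Fintype.card ι) = (univ : Finset (Fin n)).map ⟨_, hinj⟩ := by
    ext j
    simp only [hn, Finset.mem_Icc, Finset.mem_map, Finset.mem_univ, true_and,
      Function.Embedding.coeFn_mk]
    exact ⟨fun hj => ⟨⟨j - 1, by omega⟩, Nat.sub_add_cancel hj.1⟩,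
      fun ⟨a, ha⟩ => by have := a.2; omega⟩
  rw [eigSum, h, Finset.powersetCard_map, Finset.map_val, Multiset.map_map]
  congr 1
  refine Multiset.map_congr rfl fun A _ => ?_
  simp

/-! ### Creation and annihilation operators -/

section Fock

variable {V : Type*} [LinearOrder V]

/-- The sign `(-1)^{|{v ∈ σ | v < u}|}`. -/
def vertexSign (u : V) (σ : Finset V) : ℝ := (-1) ^ #{v ∈ σ | v < u}

theorem vertexSign_mul_self (u : V) (σ : Finset V) : vertexSign u σ * vertexSign u σ = 1 := by
  rw [vertexSign, ← pow_add, ← two_mul, pow_mul]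
  simp

theorem vertexSign_sq (u : V) (σ : Finset V) : vertexSign u σ ^ 2 = 1 := by
  rw [sq, vertexSign_mul_self]

theorem vertexSign_insert {u v : V} {σ : Finset V} (hv : v ∉ σ) :
    vertexSign u (insert v σ) = (if v < u then -1 else 1) * vertexSign u σ := by
  rw [vertexSign, vertexSign, Finset.filter_insert]
  split_ifs with h
  · rw [card_insert_of_notMem (by simp [hv]), pow_succ']
  · rw [one_mul]

theorem vertexSign_insert_self (u : V) (σ : Finset V) :
    vertexSign u (insert u σ) = vertexSign u σ := by
  rw [vertexSign, vertexSign, Finset.filter_insert, if_neg (lt_irrefl u)]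

theorem vertexSign_erase_self (u : V) (σ : Finset V) :
    vertexSign u (σ.erase u) = vertexSign u σ := by
  rw [← vertexSign_insert_self u (σ.erase u)]
  by_cases h : u ∈ σ
  · rw [insert_erase h]
  · rw [erase_eq_of_notMem h, vertexSign_insert_self]

/-- Inserting two vertices in the two orders gives opposite signs. -/
theorem vertexSign_insert_mul {u v : V} {σ : Finset V} (huv : u ≠ v) (hu : u ∉ σ) (hv : v ∉ σ) :
    vertexSign u (insert v σ) * vertexSign v σ = -(vertexSign v (insert u σ) * vertexSign u σ) := by
  rw [vertexSign_insert hv, vertexSign_insert hu]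
  rcases lt_or_gt_of_ne huv with h | h
  · rw [if_neg h.not_gt, if_pos h]; ring
  · rw [if_neg h.not_gt, if_pos h]; ring

/-- Exactly one of `u < v` and `v < u` holds, so exactly one of the two factors changes sign. -/
theorem vertexSign_insert_mul_insert {u v : V} {σ : Finset V} (huv : u ≠ v) (hu : u ∉ σ)
    (hv : v ∉ σ) :
    vertexSign u (insert v σ) * vertexSign v (insert u σ) = -(vertexSign u σ * vertexSign v σ) := by
  rw [vertexSign_insert hv, vertexSign_insert hu]
  rcases lt_or_gt_of_ne huv with h | h
  · rw [if_neg h.not_gt, if_pos h]; ring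
  · rw [if_neg h.not_gt, if_pos h]; ring

/-- The operator that removes the vertex `u`. -/
def annihilation (u : V) : (Finset V → ℝ) →ₗ[ℝ] (Finset V → ℝ) where
  toFun f σ := if u ∈ σ then 0 else vertexSign u σ * f (insert u σ)
  map_add' f g := by ext σ; by_cases h : u ∈ σ <;> simp [h, mul_add]
  map_smul' c f := by ext σ; by_cases h : u ∈ σ <;> simp [h, mul_left_comm]

/-- The operator that adds the vertex `u`. -/
def creation (u : V) : (Finset V → ℝ) →ₗ[ℝ] (Finset V → ℝ) where
  toFun f σ := if u ∈ σ then vertexSign u σ * f (σ.erase u) else 0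
  map_add' f g := by ext σ; by_cases h : u ∈ σ <;> simp [h, mul_add]
  map_smul' c f := by ext σ; by_cases h : u ∈ σ <;> simp [h, mul_left_comm]

theorem annihilation_apply (u : V) (f : Finset V → ℝ) (σ : Finset V) :
    annihilation u f σ = if u ∈ σ then 0 else vertexSign u σ * f (insert u σ) := rfl

theorem creation_apply (u : V) (f : Finset V → ℝ) (σ : Finset V) :
    creation u f σ = if u ∈ σ then vertexSign u σ * f (σ.erase u) else 0 := rfl

theorem creation_creation (u v : V) (f : Finset V → ℝ) :
    creation u (creation v f) = -creation v (creation u f) := by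
  ext σ
  simp only [creation_apply, Pi.neg_apply, mem_erase]
  rcases eq_or_ne u v with rfl | huv
  · simp
  by_cases hu : u ∈ σ
  · by_cases hv : v ∈ σ
    · obtain ⟨π, hπu, hπv, rfl⟩ : ∃ π : Finset V, u ∉ π ∧ v ∉ π ∧ σ = insert u (insert v π) :=
        ⟨(σ.erase u).erase v, by simp, by simp, by
          rw [insert_erase (mem_erase.2 ⟨huv.symm, hv⟩), insert_erase hu]⟩
      have h1 : (insert u (insert v π)).erase u = insert v π :=
        erase_insert (by simp [huv, hπu])
      have h2 : (insert u (insert v π)).erase v = insert u π := by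
        rw [insert_comm]; exact erase_insert (by simp [huv.symm, hπv])
      rw [h1, h2, erase_insert hπu, erase_insert hπv, vertexSign_insert_self,
        insert_comm u v, vertexSign_insert_self, vertexSign_insert_self, vertexSign_insert_self]
      simp only [mem_insert, true_or, or_true, if_true, huv, huv.symm, ne_eq, not_false_eq_true,
        and_self]
      linear_combination f π * vertexSign_insert_mul huv hπu hπv
    · simp [hv]
  · simp [hu]

/-- Together with `creation_creation`, these are the canonical anticommutation relations, from which
the spectral statements below follow without further work on signs. -/
theorem annihilation_creation (u v : V) (f : Finset V → ℝ) :
    annihilation u (creation v f) + creation v (annihilation u f) = if u = v then f else 0 := by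
  ext σ
  simp only [creation_apply, annihilation_apply, Pi.add_apply, mem_insert, mem_erase]
  rcases eq_or_ne u v with rfl | huv
  · by_cases hu : u ∈ σ
    · simp [hu, ← mul_assoc, vertexSign_erase_self, vertexSign_mul_self]
    · simp [hu, ← mul_assoc, vertexSign_insert_self, vertexSign_mul_self]
  by_cases hu : u ∈ σ
  · simp [hu, huv]
  by_cases hv : v ∈ σ
  · obtain ⟨π, hπv, rfl⟩ : ∃ π : Finset V, v ∉ π ∧ σ = insert v π :=
      ⟨σ.erase v, by simp, (insert_erase hv).symm⟩
    have hπu : u ∉ π := fun h => hu (mem_insert_of_mem h)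
    have h1 : (insert u (insert v π)).erase v = insert u π := by
      rw [insert_comm]; exact erase_insert (by simp [huv.symm, hπv])
    rw [h1, erase_insert hπv, insert_comm u v, vertexSign_insert_self, vertexSign_insert_self]
    simp only [hu, mem_insert, true_or, or_true, if_true, if_false, huv, and_false,
      Pi.zero_apply]
    linear_combination f (insert u π) * vertexSign_insert_mul_insert huv hπu hπv
  · simp [hu, hv, huv, huv.symm]

variable [Fintype V]

/-- Inserting `u` is a bijection from the sets avoiding `u` to those containing it. The zero
branches keep both sums over all of `Finset V`, so that sums over different vertices can be
interchanged. -/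
theorem sum_insert_eq_sum_mem (u : V) (F : Finset V → ℝ) :
    ∑ σ, (if u ∈ σ then 0 else F (insert u σ)) = ∑ σ, if u ∈ σ then F σ else 0 := by
  have h1 : ∑ σ, (if u ∈ σ then 0 else F (insert u σ)) =
      ∑ σ ∈ univ.filter (u ∉ ·), F (insert u σ) := by
    rw [sum_filter]
    exact sum_congr rfl fun σ _ => by split_ifs <;> simp_all
  rw [h1, ← sum_filter]
  refine sum_nbij' (fun σ => insert u σ) (fun σ => σ.erase u) ?_ ?_ ?_ ?_ ?_
  · intro σ _; simp
  · intro σ _; simp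
  · intro σ hσ; exact erase_insert (by simpa using hσ)
  · intro σ hσ; exact insert_erase (by simpa using hσ)
  · intro σ _; rfl

theorem creation_dotProduct (u : V) (f g : Finset V → ℝ) :
    creation u f ⬝ᵥ g = f ⬝ᵥ annihilation u g := by
  have := sum_insert_eq_sum_mem u fun σ => vertexSign u σ * f (σ.erase u) * g σ
  calc creation u f ⬝ᵥ g = ∑ σ, if u ∈ σ then vertexSign u σ * f (σ.erase u) * g σ else 0 :=
        sum_congr rfl fun σ _ => by rw [creation_apply]; split_ifs <;> simp
    _ = _ := by
      rw [← this]
      refine sum_congr rfl fun σ _ => ?_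
      rw [annihilation_apply]
      split_ifs with h
      · simp
      · rw [erase_insert h, vertexSign_insert_self]; ring

/-- The annihilation operator of a vector of coefficients. -/
def annihilationOf (c : V → ℝ) : (Finset V → ℝ) →ₗ[ℝ] (Finset V → ℝ) :=
  ∑ u, c u • annihilation u

/-- The creation operator of a vector of coefficients. -/
def creationOf (c : V → ℝ) : (Finset V → ℝ) →ₗ[ℝ] (Finset V → ℝ) :=
  ∑ u, c u • creation u

theorem annihilationOf_apply (c : V → ℝ) (f : Finset V → ℝ) :
    annihilationOf c f = ∑ u, c u • annihilation u f := by
  simp [annihilationOf]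

theorem creationOf_apply (c : V → ℝ) (f : Finset V → ℝ) :
    creationOf c f = ∑ u, c u • creation u f := by
  simp [creationOf]

theorem creationOf_dotProduct (c : V → ℝ) (f g : Finset V → ℝ) :
    creationOf c f ⬝ᵥ g = f ⬝ᵥ annihilationOf c g := by
  rw [creationOf_apply, annihilationOf_apply, sum_dotProduct, dotProduct_sum]
  refine sum_congr rfl fun u _ => ?_
  rw [smul_dotProduct, dotProduct_smul, creation_dotProduct]

theorem creationOf_creationOf (c d : V → ℝ) (f : Finset V → ℝ) :
    creationOf c (creationOf d f) = -creationOf d (creationOf c f) := by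
  simp only [creationOf_apply, map_sum, map_smul, smul_sum]
  rw [sum_comm, ← sum_neg_distrib]
  refine sum_congr rfl fun u _ => ?_
  rw [← sum_neg_distrib]
  refine sum_congr rfl fun v _ => ?_
  rw [creation_creation v u, smul_neg, smul_neg, neg_neg, smul_comm]

theorem annihilationOf_creationOf (c d : V → ℝ) (f : Finset V → ℝ) :
    annihilationOf c (creationOf d f) + creationOf d (annihilationOf c f) = (c ⬝ᵥ d) • f := by
  simp only [creationOf_apply, annihilationOf_apply, map_sum, map_smul, smul_sum]
  rw [sum_comm, ← sum_add_distrib, dotProduct, sum_smul]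
  refine sum_congr rfl fun u _ => ?_
  rw [← sum_add_distrib, sum_eq_single u]
  · rw [smul_comm (d u) (c u), ← smul_add, ← smul_add, annihilation_creation, if_pos rfl, mul_smul]
  · intro v _ hv
    rw [smul_comm (d v) (c u), ← smul_add, ← smul_add, annihilation_creation, if_neg hv.symm]
    simp
  · simp

/-- The number operator of a vector of coefficients. -/
def numberOf (c : V → ℝ) : (Finset V → ℝ) →ₗ[ℝ] (Finset V → ℝ) :=
  creationOf c ∘ₗ annihilationOf c

theorem numberOf_apply (c : V → ℝ) (f : Finset V → ℝ) :
    numberOf c f = creationOf c (annihilationOf c f) := rfl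

theorem numberOf_dotProduct (c : V → ℝ) (f g : Finset V → ℝ) :
    numberOf c f ⬝ᵥ g = f ⬝ᵥ numberOf c g := by
  rw [numberOf_apply, numberOf_apply, creationOf_dotProduct, dotProduct_comm,
    ← creationOf_dotProduct, dotProduct_comm]

/-- Moving `creationOf d` past the annihilation and then past the creation costs one sign each;
orthogonality removes the scalar term. -/
theorem numberOf_creationOf_of_orthogonal {c d : V → ℝ} (h : c ⬝ᵥ d = 0) (f : Finset V → ℝ) :
    numberOf c (creationOf d f) = creationOf d (numberOf c f) := by
  have h1 : annihilationOf c (creationOf d f) = -creationOf d (annihilationOf c f) := by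
    have := annihilationOf_creationOf c d f
    rw [h, zero_smul] at this
    exact eq_neg_of_add_eq_zero_left this
  rw [numberOf_apply, h1, map_neg, creationOf_creationOf c d, neg_neg, numberOf_apply]

theorem annihilationOf_creationOf_self {c : V → ℝ} (h : c ⬝ᵥ c = 1) {f : Finset V → ℝ}
    (hf : numberOf c f = 0) : annihilationOf c (creationOf c f) = f := by
  have := annihilationOf_creationOf c c f
  rw [numberOf_apply] at hf
  rwa [hf, h, add_zero, one_smul] at this

/-- The joint eigenvectors of the number operators of an orthonormal family. -/
theorem exists_joint_eigenvector {κ : Type*} [DecidableEq κ] {v : κ → V → ℝ}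
    (hv : ∀ a b, v a ⬝ᵥ v b = if a = b then 1 else 0) (A : Finset κ) :
    ∃ f : Finset V → ℝ, f ⬝ᵥ f = 1 ∧ (∀ σ, #σ ≠ #A → f σ = 0) ∧
      ∀ j, numberOf (v j) f = (if j ∈ A then (1 : ℝ) else 0) • f := by
  induction A using Finset.induction_on with
  | empty =>
    -- The vacuum vector, killed by every annihilation operator.
    refine ⟨Pi.single ∅ 1, by simp, fun σ hσ => ?_, fun j => ?_⟩
    · rw [card_empty, Ne, card_eq_zero] at hσ
      simp [hσ]
    · have : ∀ u : V, annihilation u (Pi.single ∅ (1 : ℝ)) = 0 := fun u => by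
        ext σ
        simp [annihilation_apply]
      simp [numberOf_apply, annihilationOf_apply, this]
  | insert a A ha ih =>
    obtain ⟨f, hf1, hf2, hf3⟩ := ih
    have hNa : numberOf (v a) f = 0 := by rw [hf3, if_neg ha, zero_smul]
    have hva : v a ⬝ᵥ v a = 1 := by rw [hv, if_pos rfl]
    have hback := annihilationOf_creationOf_self hva hNa
    -- Wedging with `v a` preserves the norm, since `annihilationOf (v a)` undoes it on `f` when `a
    -- ∉ A`.
    refine ⟨creationOf (v a) f, ?_, fun σ hσ => ?_, fun j => ?_⟩
    · rw [creationOf_dotProduct, hback, hf1]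
    · rw [card_insert_of_notMem ha] at hσ
      rw [creationOf_apply, Finset.sum_apply]
      refine sum_eq_zero fun u _ => ?_
      rw [Pi.smul_apply, creation_apply]
      split_ifs with hu
      · rw [hf2 _ fun h => hσ (by rw [← h, card_erase_add_one hu]), mul_zero, smul_zero]
      · rw [smul_zero]
    · rcases eq_or_ne j a with rfl | hj
      · rw [numberOf_apply, hback, if_pos (mem_insert_self _ _), one_smul]
      · rw [numberOf_creationOf_of_orthogonal (by rw [hv, if_neg hj]), hf3, map_smul]
        simp [mem_insert, hj]

/-! ### Spectrum of the second quantization -/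

/-- The second quantization `∑ M_{uv} a_u† a_v` of a matrix: its restriction to the functions
supported on the `k`-subsets is the `k`-th additive compound. -/
def derivation (M : Matrix V V ℝ) (f : Finset V → ℝ) : Finset V → ℝ :=
  ∑ u, ∑ v, M u v • creation u (annihilation v f)

theorem derivation_eq_sum_numberOf {κ : Type*} [Fintype κ] [DecidableEq κ]
    (hcard : Fintype.card κ = Fintype.card V) {M : Matrix V V ℝ} {v : κ → V → ℝ} {l : κ → ℝ}
    (hv : ∀ a b, v a ⬝ᵥ v b = if a = b then 1 else 0) (hMv : ∀ a, M *ᵥ v a = l a • v a)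
    (f : Finset V → ℝ) : derivation M f = ∑ a, l a • numberOf (v a) f := by
  -- The spectral decomposition `M = ∑ l_a v_a v_aᵀ`, entry by entry.
  have hM : ∀ u w, M u w = ∑ a, l a * (v a u * v a w) := by
    intro u w
    have h := dotProduct_eq_sum_of_orthonormal hcard hv (Pi.single w 1) (M u)
    rw [single_one_dotProduct] at h
    rw [h]
    refine sum_congr rfl fun a _ => ?_
    have h2 := congrFun (hMv a) u
    rw [Pi.smul_apply, smul_eq_mul, Matrix.mulVec] at h2
    rw [dotProduct_comm (v a) (M u), h2, dotProduct_single_one]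
    ring
  simp only [derivation, hM, numberOf_apply, annihilationOf_apply, creationOf_apply, map_sum,
    map_smul, sum_smul, smul_sum, mul_smul]
  rw [sum_comm, sum_comm (s := (univ : Finset κ))]
  refine sum_congr rfl fun u _ => ?_
  rw [sum_comm (s := (univ : Finset κ))]
  exact sum_congr rfl fun w _ => sum_congr rfl fun a _ => by rw [smul_comm (v a w)]

theorem dotProduct_derivation (M : Matrix V V ℝ) (f : Finset V → ℝ) :
    f ⬝ᵥ derivation M f = ∑ u, ∑ v, M u v * (annihilation u f ⬝ᵥ annihilation v f) := by
  simp only [derivation, dotProduct_sum, dotProduct_smul, smul_eq_mul]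
  refine sum_congr rfl fun u _ => sum_congr rfl fun v _ => ?_
  rw [dotProduct_comm, creation_dotProduct, dotProduct_comm]

/-- The spectral decomposition of the second quantization of a symmetric matrix. -/
theorem exists_eigenbasis_derivation {κ : Type*} [Fintype κ] [DecidableEq κ]
    (hcard : Fintype.card κ = Fintype.card V) {M : Matrix V V ℝ} {v : κ → V → ℝ} {l : κ → ℝ}
    (hv : ∀ a b, v a ⬝ᵥ v b = if a = b then 1 else 0) (hMv : ∀ a, M *ᵥ v a = l a • v a) :
    ∃ w : Finset κ → Finset V → ℝ, (∀ A B, w A ⬝ᵥ w B = if A = B then 1 else 0) ∧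
      (∀ A σ, #σ ≠ #A → w A σ = 0) ∧
      ∀ f, f ⬝ᵥ derivation M f = ∑ A, (∑ j ∈ A, l j) * (w A ⬝ᵥ f) ^ 2 := by
  choose w hw1 hw2 hw3 using exists_joint_eigenvector hv
  have horth : ∀ A B, w A ⬝ᵥ w B = if A = B then 1 else 0 := by
    intro A B
    split_ifs with h
    · rw [h, hw1]
    -- A self-adjoint number operator with eigenvalue `1` on one vector and `0` on the other
    -- separates them.
    · obtain ⟨j, hj⟩ : ∃ j, ¬(j ∈ A ↔ j ∈ B) := by
        by_contra! h'
        exact h (Finset.ext h')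
      have := numberOf_dotProduct (v j) (w A) (w B)
      rw [hw3, hw3, smul_dotProduct, dotProduct_smul, smul_eq_mul, smul_eq_mul] at this
      by_cases hA : j ∈ A <;> by_cases hB : j ∈ B <;> simp_all
  refine ⟨w, horth, hw2, fun f => ?_⟩
  -- The family is complete because both index sets have `2 ^ |V|` elements.
  rw [dotProduct_eq_sum_of_orthonormal (by rw [Fintype.card_finset, Fintype.card_finset, hcard])
    horth]
  refine sum_congr rfl fun A _ => ?_
  have : w A ⬝ᵥ derivation M f = (∑ j ∈ A, l j) * (w A ⬝ᵥ f) := by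
    rw [derivation_eq_sum_numberOf hcard hv hMv, dotProduct_sum, sum_mul,
      ← sum_subset (subset_univ A)]
    · refine sum_congr rfl fun j hj => ?_
      rw [dotProduct_smul, ← numberOf_dotProduct, hw3, if_pos hj, one_smul, smul_eq_mul]
    · intro j _ hj
      rw [dotProduct_smul, ← numberOf_dotProduct, hw3, if_neg hj, zero_smul, zero_dotProduct,
        smul_zero]
  rw [this]
  ring

end Fock

theorem IsFace.mono {V : Type*} {X : AbstractSimplicialComplex V} {σ τ : Finset V} (hτ : IsFace X τ)
    (h : σ ⊆ τ) : IsFace X σ := by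
  rcases σ.eq_empty_or_nonempty with rfl | hσ
  · exact Or.inl rfl
  · rcases hτ with rfl | hτ
    · exact absurd (subset_empty.1 h) hσ.ne_empty
    · exact Or.inr ((X.isRelLowerSet_faces hτ).2 h hσ)

/-! ### Comparison of the upper Laplacian with the graph Laplacian -/

section Estimate

variable {V : Type*} [LinearOrder V]

theorem singleton_mem_link {X : AbstractSimplicialComplex V} {σ : Finset V} {u : V} :
    {u} ∈ link X σ ↔ IsFace X (insert u σ) ∧ u ∉ σ := by
  have : IsFace X {u} := Or.inr (X.singleton_mem u)
  simp only [link, Set.mem_ofPred_eq, this, true_and, union_singleton,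
    ← disjoint_iff_inter_eq_empty, disjoint_singleton_right]

theorem singleton_mem_link_singleton {X : AbstractSimplicialComplex V} {u v : V} :
    {u} ∈ link X {v} ↔ (graph X).Adj v u := by
  rw [singleton_mem_link, mem_singleton, graph, and_comm, pair_comm, eq_comm]

theorem adj_of_isFace {X : AbstractSimplicialComplex V} {σ : Finset V} {u v : V} (huv : u ≠ v)
    (hσ : IsFace X σ) (hu : u ∈ σ) (hv : v ∈ σ) : (graph X).Adj u v :=
  ⟨huv, hσ.mono (by simp [insert_subset_iff, hu, hv])⟩

/-- The pairs of `k`-faces `π ∪ {u}`, `π ∪ {v}` joined by an edge of the `1`-skeleton, but not by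
a face. -/
def IsBad (X : AbstractSimplicialComplex V) (u v : V) (π : Finset V) : Prop :=
  (graph X).Adj u v ∧ ¬IsFace X (insert u (insert v π)) ∧ IsFace X (insert v π) ∧ v ∉ π

variable [Fintype V]

open scoped Classical in
-- If `v` misses a neighbour in `σ`, at most `k` adjacencies remain and no pair is bad. If `v` is
-- adjacent to all of `σ`, there are `k + 1` adjacencies: the extra `1` is paid by the coface
-- `insert v σ` if it is a face, and otherwise by the defect term, whose `j` also pays for the bad
-- pairs.
theorem card_adj_add_card_isBad_le (X : AbstractSimplicialComplex V) {σ : Finset V} {k : ℕ}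
    (hσ : #σ = k + 1) (v : V) :
    #{u ∈ σ | (graph X).Adj u v} + #{u ∈ σ | IsBad X u v (σ.erase u)} ≤
      k + (if v ∉ σ ∧ IsFace X (insert v σ) then 1 else 0) +
        if {v} ∉ link X σ ∧ ∀ u ∈ σ, {v} ∈ link X {u} then
          #{w ∈ σ | {v} ∈ link X (σ \ {w})} + 1 else 0 := by
  simp only [singleton_mem_link_singleton]
  by_cases hall : ∀ u ∈ σ, (graph X).Adj u v
  · have hv : v ∉ σ := fun h => (graph X).loopless.irrefl v (hall v h)
    have h1 : #{u ∈ σ | (graph X).Adj u v} = k + 1 := by rw [filter_true_of_mem hall, hσ]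
    by_cases hf : IsFace X (insert v σ)
    · have h2 : #{u ∈ σ | IsBad X u v (σ.erase u)} = 0 := by
        rw [card_eq_zero, filter_eq_empty_iff]
        intro u hu hbad
        apply hbad.2.1
        rwa [insert_comm, insert_erase hu]
      rw [h1, h2, if_pos ⟨hv, hf⟩]
      omega
    · have h2 : #{u ∈ σ | IsBad X u v (σ.erase u)} ≤ #{w ∈ σ | {v} ∈ link X (σ \ {w})} := by
        refine card_le_card (monotone_filter_right σ fun u _ hbad => ?_)
        rw [singleton_mem_link, sdiff_singleton_eq_erase]
        exact ⟨hbad.2.2.1, hbad.2.2.2⟩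
      rw [h1, if_neg fun h => hf h.2, if_pos ⟨fun h => hf (singleton_mem_link.1 h).1, hall⟩]
      omega
  · have h1 : #{u ∈ σ | (graph X).Adj u v} < #σ := by
      refine card_lt_card (filter_ssubset.2 ?_)
      push Not at hall
      exact hall
    have h2 : #{u ∈ σ | IsBad X u v (σ.erase u)} = 0 := by
      rw [card_eq_zero, filter_eq_empty_iff]
      intro u hu hbad
      refine hall fun w hw => ?_
      rcases eq_or_ne w u with rfl | hwu
      · exact hbad.1
      · have hw' : w ∈ σ.erase u := mem_erase.2 ⟨hwu, hw⟩
        exact adj_of_isFace (fun h => hbad.2.2.2 (h ▸ hw')) hbad.2.2.1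
          (mem_insert_of_mem hw') (mem_insert_self _ _)
    omega

open scoped Classical in
-- A vertex satisfying the first two conditions lies in `defect X σ j` for exactly one `j`, and `j ≤
-- #σ = k + 1` puts it in the range.
theorem sum_defect_eq (X : AbstractSimplicialComplex V) {σ : Finset V} {k : ℕ}
    (hσ : #σ = k + 1) :
    ∑ j ∈ range (k + 2), (j + 1) * #(defect X σ j) =
      ∑ v, if {v} ∉ link X σ ∧ ∀ u ∈ σ, {v} ∈ link X {u} then
          #{w ∈ σ | {v} ∈ link X (σ \ {w})} + 1 else 0 := by
  have hcard : ∀ j, #(defect X σ j) = ∑ v, if {v} ∉ link X σ ∧ (∀ u ∈ σ, {v} ∈ link X {u}) ∧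
      #{w ∈ σ | {v} ∈ link X (σ \ {w})} = j then 1 else 0 := fun j => card_filter _ _
  simp only [hcard, mul_sum]
  rw [sum_comm]
  refine sum_congr rfl fun v _ => ?_
  by_cases h : {v} ∉ link X σ ∧ ∀ u ∈ σ, {v} ∈ link X {u}
  · rw [if_pos h, sum_eq_single #{w ∈ σ | {v} ∈ link X (σ \ {w})}]
    · rw [if_pos ⟨h.1, h.2, rfl⟩, mul_one]
    · intro j _ hj
      rw [if_neg fun h' => hj h'.2.2.symm, mul_zero]
    · intro hj
      refine absurd (mem_range.2 ?_) hj
      have := card_filter_le σ fun w => {v} ∈ link X (σ \ {w})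
      omega
  · rw [if_neg h]
    exact sum_eq_zero fun j _ => by rw [if_neg fun h' => h ⟨h'.1, h'.2.1⟩, mul_zero]

open scoped Classical in
theorem sum_card_adj_add_card_isBad_le (X : AbstractSimplicialComplex V) {σ : Finset V} {k : ℕ}
    (hσ : #σ = k + 1) :
    ∑ v, (#{u ∈ σ | (graph X).Adj u v} + #{u ∈ σ | IsBad X u v (σ.erase u)}) ≤
      k * Fintype.card V + ∑ v, (if v ∉ σ ∧ IsFace X (insert v σ) then 1 else 0) +
        ∑ j ∈ range (k + 2), (j + 1) * #(defect X σ j) := by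
  rw [sum_defect_eq X hσ]
  refine (sum_le_sum fun v _ => card_adj_add_card_isBad_le X hσ v).trans_eq ?_
  rw [sum_add_distrib, sum_add_distrib, sum_const, card_univ, smul_eq_mul, mul_comm]

/-- The off-diagonal entries of the upper Laplacian in terms of annihilation operators. -/
theorem sum_creation_mul_creation {u v : V} (huv : u ≠ v) (g f : Finset V → ℝ) :
    ∑ ρ, g ρ * (creation u f ρ * creation v f ρ) =
      -∑ π, g (insert u (insert v π)) * (annihilation u f π * annihilation v f π) := by
  have h1 : ∑ ρ, g ρ * (creation u f ρ * creation v f ρ) =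
      ∑ ρ, if u ∈ ρ then g ρ * (creation u f ρ * creation v f ρ) else 0 :=
    sum_congr rfl fun ρ _ => by
      by_cases h : u ∈ ρ
      · rw [if_pos h]
      · rw [if_neg h, creation_apply, if_neg h, zero_mul, mul_zero]
  rw [h1, ← sum_insert_eq_sum_mem u]
  have h2 : ∑ π, (if u ∈ π then 0 else
        g (insert u π) * (creation u f (insert u π) * creation v f (insert u π))) =
      ∑ π, if v ∈ π then (if u ∈ π then 0 else
        g (insert u π) * (creation u f (insert u π) * creation v f (insert u π))) else 0 :=
    sum_congr rfl fun π _ => by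
      by_cases h : v ∈ π
      · rw [if_pos h]
      · have hv : v ∉ insert u π := by simp [h, huv.symm]
        rw [if_neg h, creation_apply v, if_neg hv, mul_zero, mul_zero, ite_self]
  rw [h2, ← sum_insert_eq_sum_mem v, ← sum_neg_distrib]
  refine sum_congr rfl fun π _ => ?_
  simp only [annihilation_apply, creation_apply, mem_insert, true_or, or_true, if_true]
  by_cases hv : v ∈ π
  · simp [hv]
  by_cases hu : u ∈ π
  · simp [hu]
  have e1 : (insert u (insert v π)).erase u = insert v π := erase_insert (by simp [huv, hu])
  have e2 : (insert u (insert v π)).erase v = insert u π := by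
    rw [insert_comm]; exact erase_insert (by simp [huv.symm, hv])
  rw [if_neg hv, if_neg (by simp [huv, hu]), if_neg hu, if_neg hv, e1, e2, vertexSign_insert_self,
    insert_comm u v, vertexSign_insert_self]
  linear_combination g (insert v (insert u π)) * f (insert u π) * f (insert v π) *
    vertexSign_insert_mul_insert huv hu hv

theorem sum_mul_creation_sq (u : V) (g f : Finset V → ℝ) :
    ∑ ρ, g ρ * creation u f ρ ^ 2 = ∑ σ, (if u ∈ σ then 0 else g (insert u σ)) * f σ ^ 2 := by
  have h1 : ∑ ρ, g ρ * creation u f ρ ^ 2 =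
      ∑ ρ, if u ∈ ρ then g ρ * f (ρ.erase u) ^ 2 else 0 :=
    sum_congr rfl fun ρ _ => by
      rw [creation_apply]
      split_ifs
      · rw [mul_pow, vertexSign_sq, one_mul]
      · simp
  rw [h1, ← sum_insert_eq_sum_mem u]
  refine sum_congr rfl fun σ _ => ?_
  split_ifs with h
  · simp
  · rw [erase_insert h]

theorem sum_mul_annihilation_sq (u : V) (g f : Finset V → ℝ) :
    ∑ π, g π * annihilation u f π ^ 2 =
      ∑ σ, (if u ∈ σ then g (σ.erase u) else 0) * f σ ^ 2 := by
  have h1 : ∑ σ, (if u ∈ σ then g (σ.erase u) else 0) * f σ ^ 2 =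
      ∑ σ, if u ∈ σ then g (σ.erase u) * f σ ^ 2 else 0 :=
    sum_congr rfl fun σ _ => by split_ifs <;> simp
  rw [h1, ← sum_insert_eq_sum_mem u]
  refine sum_congr rfl fun π _ => ?_
  rw [annihilation_apply]
  split_ifs with h
  · simp
  · rw [erase_insert h, mul_pow, vertexSign_sq, one_mul]

open scoped Classical in
theorem degree_eq_sum (X : AbstractSimplicialComplex V) (u : V) :
    ((graph X).degree u : ℝ) = ∑ v, if (graph X).Adj u v then 1 else 0 := by
  rw [← SimpleGraph.card_neighborFinset_eq_degree, SimpleGraph.neighborFinset_eq_filter,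
    card_filter]
  push_cast
  rfl

open scoped Classical in
/-- The difference between the upper Laplacian and the second quantization of `L(G_X)`, for a
pair of distinct vertices. -/
theorem offDiag_form_ge {X : AbstractSimplicialComplex V} {f : Finset V → ℝ}
    (hf : ∀ σ, f σ ≠ 0 → IsFace X σ) {u v : V} (huv : u ≠ v) :
    -(∑ σ, (if u ∈ σ then if IsBad X u v (σ.erase u) then 1 else 0 else 0) * f σ ^ 2 +
        ∑ σ, (if v ∈ σ then if IsBad X v u (σ.erase v) then 1 else 0 else 0) * f σ ^ 2) / 2 ≤
      ∑ ρ, (if IsFace X ρ then 1 else 0) * (creation u f ρ * creation v f ρ) -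
        (graph X).lapMatrix ℝ u v * (annihilation u f ⬝ᵥ annihilation v f) := by
  have hlap : (graph X).lapMatrix ℝ u v = -if (graph X).Adj u v then 1 else 0 := by
    rw [SimpleGraph.lapMatrix, Matrix.sub_apply, SimpleGraph.degMatrix,
      Matrix.diagonal_apply_ne _ huv, SimpleGraph.adjMatrix_apply, zero_sub]
  rw [sum_creation_mul_creation huv, hlap,
    ← sum_mul_annihilation_sq u fun π => if IsBad X u v π then 1 else 0,
    ← sum_mul_annihilation_sq v fun π => if IsBad X v u π then 1 else 0, dotProduct,
    neg_mul, sub_neg_eq_add, mul_sum, ← sum_neg_distrib, ← sum_add_distrib, ← sum_add_distrib,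
    ← sum_neg_distrib, sum_div]
  refine sum_le_sum fun π _ => ?_
  have hnonneg : ∀ (p : Prop) (y : ℝ), 0 ≤ (if p then 1 else 0) * y ^ 2 := fun p y => by
    split_ifs <;> positivity
  -- Where the product is nonzero, the support of `f` forces both `insert u π` and `insert v π` to
  -- be faces.
  by_cases h0 : annihilation u f π * annihilation v f π = 0
  · rw [h0]
    have h1 := hnonneg (IsBad X u v π) (annihilation u f π)
    have h2 := hnonneg (IsBad X v u π) (annihilation v f π)
    linarith
  have hsupp : ∀ w, annihilation w f π ≠ 0 → w ∉ π ∧ IsFace X (insert w π) := by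
    intro w hw
    rw [annihilation_apply] at hw
    split_ifs at hw with h
    · exact absurd rfl hw
    · exact ⟨h, hf _ (right_ne_zero_of_mul hw)⟩
  obtain ⟨hu, hfu⟩ := hsupp u (left_ne_zero_of_mul h0)
  obtain ⟨hv, hfv⟩ := hsupp v (right_ne_zero_of_mul h0)
  by_cases hface : IsFace X (insert u (insert v π))
  · have hadj : (graph X).Adj u v := adj_of_isFace huv hface (by simp) (by simp)
    have h1 := hnonneg (IsBad X u v π) (annihilation u f π)
    have h2 := hnonneg (IsBad X v u π) (annihilation v f π)
    rw [if_pos hface, if_pos hadj]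
    linarith
  · by_cases hadj : (graph X).Adj u v
    · have hb1 : IsBad X u v π := ⟨hadj, hface, hfv, hv⟩
      have hb2 : IsBad X v u π := ⟨hadj.symm, by rwa [insert_comm], hfu, hu⟩
      rw [if_neg hface, if_pos hadj, if_pos hb1, if_pos hb2]
      -- The only lossy case: the surplus is the product `ab` itself, and `ab ≥ -(a² + b²)/2`.
      nlinarith [sq_nonneg (annihilation u f π + annihilation v f π)]
    · have h1 := hnonneg (IsBad X u v π) (annihilation u f π)
      have h2 := hnonneg (IsBad X v u π) (annihilation v f π)
      rw [if_neg hface, if_neg hadj]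
      linarith

open scoped Classical in
theorem diag_form_eq (X : AbstractSimplicialComplex V) (f : Finset V → ℝ) (u : V) :
    ∑ ρ, (if IsFace X ρ then 1 else 0) * (creation u f ρ * creation u f ρ) -
        (graph X).lapMatrix ℝ u u * (annihilation u f ⬝ᵥ annihilation u f) =
      ∑ σ, ((if u ∉ σ ∧ IsFace X (insert u σ) then 1 else 0) -
        if u ∈ σ then ((graph X).degree u : ℝ) else 0) * f σ ^ 2 := by
  have hlap : (graph X).lapMatrix ℝ u u = (graph X).degree u := by
    rw [SimpleGraph.lapMatrix, Matrix.sub_apply, SimpleGraph.degMatrix,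
      Matrix.diagonal_apply_eq, SimpleGraph.adjMatrix_apply, if_neg ((graph X).loopless.irrefl u),
      sub_zero]
  simp only [← sq, dotProduct]
  rw [sum_mul_creation_sq u fun ρ => if IsFace X ρ then 1 else 0, hlap, mul_sum,
    sum_mul_annihilation_sq u fun _ => ((graph X).degree u : ℝ), ← sum_sub_distrib]
  refine sum_congr rfl fun σ _ => ?_
  by_cases h : u ∈ σ <;> simp [h]

open scoped Classical in
/-- The upper Laplacian dominates the second quantization of `L(G_X)` up to a diagonal term. -/
theorem form_ge {X : AbstractSimplicialComplex V} {f : Finset V → ℝ}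
    (hf : ∀ σ, f σ ≠ 0 → IsFace X σ) :
    ∑ σ, (∑ v, ((if v ∉ σ ∧ IsFace X (insert v σ) then (1 : ℝ) else 0) -
        (#{u ∈ σ | (graph X).Adj u v} + #{u ∈ σ | IsBad X u v (σ.erase u)} : ℕ))) * f σ ^ 2 ≤
      ∑ u, ∑ v, (∑ ρ, (if IsFace X ρ then 1 else 0) * (creation u f ρ * creation v f ρ) -
        (graph X).lapMatrix ℝ u v * (annihilation u f ⬝ᵥ annihilation v f)) := by
  set H : V → V → ℝ := fun u v =>
    ∑ σ, (if u ∈ σ then if IsBad X u v (σ.erase u) then 1 else 0 else 0) * f σ ^ 2 with hH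
  set E : V → ℝ := fun u => ∑ σ, ((if u ∉ σ ∧ IsFace X (insert u σ) then 1 else 0) -
        if u ∈ σ then ((graph X).degree u : ℝ) else 0) * f σ ^ 2 with hE
  have hHself : ∀ u, H u u = 0 := fun u => sum_eq_zero fun σ _ => by
    rw [if_neg (c := IsBad X u u _) fun h => (graph X).loopless.irrefl u h.1, ite_self, zero_mul]
  have hle : ∑ u, ∑ v, ((if u = v then E u else 0) - (H u v + H v u) / 2) ≤
      ∑ u, ∑ v, (∑ ρ, (if IsFace X ρ then 1 else 0) * (creation u f ρ * creation v f ρ) -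
        (graph X).lapMatrix ℝ u v * (annihilation u f ⬝ᵥ annihilation v f)) := by
    refine sum_le_sum fun u _ => sum_le_sum fun v _ => ?_
    rcases eq_or_ne u v with rfl | huv
    · rw [if_pos rfl, hHself, diag_form_eq]
      simp [hE]
    · have := offDiag_form_ge hf huv
      rw [if_neg huv, zero_sub, ← neg_div]
      exact this
  refine le_of_eq_of_le ?_ hle
  -- Over ordered pairs the symmetrized halves add up to each `H u v` exactly once.
  have hsymm : ∑ u, ∑ v, (H u v + H v u) / 2 = ∑ v, ∑ u, H u v := by
    simp only [add_div, sum_add_distrib]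
    rw [sum_comm (f := fun u v => H u v / 2), ← sum_add_distrib]
    refine sum_congr rfl fun v _ => ?_
    rw [← sum_add_distrib]
    exact sum_congr rfl fun u _ => by ring
  have hEE : ∑ u, ∑ v, (if u = v then E u else 0) = ∑ u, E u := by simp
  simp only [sum_sub_distrib (s := (univ : Finset V))]
  rw [hEE, hsymm]
  simp only [hE, hH]
  simp only [sum_comm (s := (univ : Finset V)) (t := (univ : Finset (Finset V))), ← sum_mul]
  rw [← sum_sub_distrib]
  refine sum_congr rfl fun σ _ => ?_
  rw [← sub_mul]
  congr 1
  -- Double counting of the edges between `σ` and `V`.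
  have hdeg : ∑ u, (if u ∈ σ then ((graph X).degree u : ℝ) else 0) =
      ∑ v, (#{u ∈ σ | (graph X).Adj u v} : ℝ) := by
    simp only [degree_eq_sum, card_filter]
    rw [← sum_filter, filter_mem_eq_inter, univ_inter, sum_comm]
    push_cast
    rfl
  have hbad : ∀ v, (#{u ∈ σ | IsBad X u v (σ.erase u)} : ℝ) =
      ∑ u, if u ∈ σ then if IsBad X u v (σ.erase u) then (1 : ℝ) else 0 else 0 := by
    intro v
    rw [card_filter, ← sum_filter (· ∈ σ), filter_mem_eq_inter, univ_inter]
    push_cast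
    rfl
  simp only [sum_sub_distrib, hdeg, ← hbad, Nat.cast_add, sum_add_distrib]
  ring

end Estimate

theorem mem_facesOfCard {V : Type*} [Fintype V] {X : AbstractSimplicialComplex V} {m : ℕ} {σ : Finset V} :
    σ ∈ facesOfCard X m ↔ IsFace X σ ∧ #σ = m := by
  simp [facesOfCard]

/-! ### The simplicial Laplacian as a form on the exterior algebra -/

section Comparison

variable {V : Type*} [LinearOrder V]

theorem insert_eq_iff_of_card {u : V} {ρ τ : Finset V} (h : #τ = #ρ + 1) :
    u ∉ ρ ∧ insert u ρ = τ ↔ ρ ⊆ τ ∧ u ∈ τ \ ρ := by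
  constructor
  · rintro ⟨hu, rfl⟩
    simp [hu]
  · rintro ⟨hρ, hu⟩
    rw [mem_sdiff] at hu
    refine ⟨hu.2, eq_of_subset_of_card_le (insert_subset hu.1 hρ) ?_⟩
    rw [card_insert_of_notMem hu.2, h]

/-- Extension by zero of a function on a finite set of faces. -/
def extendZero (F : Finset (Finset V)) : (F → ℝ) →ₗ[ℝ] (Finset V → ℝ) where
  toFun x σ := if h : σ ∈ F then x ⟨σ, h⟩ else 0
  map_add' x y := by ext σ; by_cases h : σ ∈ F <;> simp [h]
  map_smul' c x := by ext σ; by_cases h : σ ∈ F <;> simp [h]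

theorem extendZero_apply_mem (F : Finset (Finset V)) (x : F → ℝ) (σ : F) :
    extendZero F x σ = x σ := dif_pos σ.2

theorem extendZero_apply_notMem {F : Finset (Finset V)} (x : F → ℝ) {σ : Finset V} (h : σ ∉ F) :
    extendZero F x σ = 0 := dif_neg h

variable [Fintype V]

/-- At most one `u` contributes. Counting the vertices below `u` in `ρ` or in `τ = insert u ρ` gives
the same sign, as `u` is not below itself. -/
theorem incidence_eq_sum {ρ τ : Finset V} (h : #τ = #ρ + 1) :
    incidence τ ρ = ∑ u, if u ∉ ρ ∧ insert u ρ = τ then vertexSign u ρ else 0 := by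
  rw [incidence]
  split_ifs with hρ
  · rw [← sum_filter]
    refine sum_congr (by ext u; simp [insert_eq_iff_of_card h, hρ]) fun u hu => ?_
    rw [← vertexSign_insert_self u ρ, (mem_filter.1 hu).2.2, vertexSign]
  · exact (sum_eq_zero fun u _ => if_neg fun hu => hρ ((insert_eq_iff_of_card h).1 hu).1).symm

theorem sum_mul_extendZero (F : Finset (Finset V)) (x : F → ℝ) (g : Finset V → ℝ) :
    ∑ σ, g σ * extendZero F x σ = ∑ σ : F, g σ * x σ := by
  rw [← sum_subset (subset_univ F) fun σ _ h => by rw [extendZero_apply_notMem x h, mul_zero],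
    ← sum_coe_sort]
  exact sum_congr rfl fun σ _ => by rw [extendZero_apply_mem]

theorem extendZero_dotProduct_self (F : Finset (Finset V)) (x : F → ℝ) :
    extendZero F x ⬝ᵥ extendZero F x = x ⬝ᵥ x := by
  rw [dotProduct, sum_mul_extendZero]
  exact sum_congr rfl fun σ _ => by rw [extendZero_apply_mem]

/-- The boundary map is annihilation by the all-ones vector, which is why `J` appears in the bound.
-/
theorem boundary_mulVec_apply (X : AbstractSimplicialComplex V) (k : ℕ)
    (x : facesOfCard X (k + 1) → ℝ) (ρ : facesOfCard X k) :
    (boundary X k *ᵥ x) ρ = ∑ u, annihilation u (extendZero _ x) ρ := by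
  have hρ := (mem_facesOfCard.1 ρ.2).2
  have h1 : (boundary X k *ᵥ x) ρ = ∑ τ : facesOfCard X (k + 1),
      (∑ u, if u ∉ (ρ : Finset V) ∧ insert u (ρ : Finset V) = τ then vertexSign u (ρ : Finset V)
        else 0) * x τ :=
    sum_congr rfl fun τ _ => by
      rw [← incidence_eq_sum (by rw [hρ, (mem_facesOfCard.1 τ.2).2])]
      rfl
  rw [h1, ← sum_mul_extendZero _ x fun τ => ∑ u, if u ∉ (ρ : Finset V) ∧
    insert u (ρ : Finset V) = τ then vertexSign u (ρ : Finset V) else 0]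
  simp only [sum_mul]
  rw [sum_comm]
  refine sum_congr rfl fun u _ => ?_
  rw [annihilation_apply, sum_eq_single (insert u (ρ : Finset V))]
  · by_cases hu : u ∈ (ρ : Finset V) <;> simp [hu]
  · intro τ _ hτ
    rw [if_neg fun h => hτ h.2.symm, zero_mul]
  · simp

theorem boundary_transpose_mulVec_apply (X : AbstractSimplicialComplex V) (k : ℕ)
    (x : facesOfCard X k → ℝ) (ρ : facesOfCard X (k + 1)) :
    ((boundary X k)ᵀ *ᵥ x) ρ = ∑ u, creation u (extendZero _ x) ρ := by
  have hρ := (mem_facesOfCard.1 ρ.2).2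
  have h1 : ((boundary X k)ᵀ *ᵥ x) ρ = ∑ σ : facesOfCard X k,
      (∑ u, if u ∉ (σ : Finset V) ∧ insert u (σ : Finset V) = ρ then vertexSign u (σ : Finset V)
        else 0) * x σ :=
    sum_congr rfl fun σ _ => by
      rw [← incidence_eq_sum (by rw [hρ, (mem_facesOfCard.1 σ.2).2])]
      rfl
  rw [h1, ← sum_mul_extendZero _ x fun σ => ∑ u, if u ∉ σ ∧
    insert u σ = (ρ : Finset V) then vertexSign u σ else 0]
  simp only [sum_mul]
  rw [sum_comm]
  refine sum_congr rfl fun u _ => ?_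
  rw [creation_apply, sum_eq_single ((ρ : Finset V).erase u)]
  · by_cases hu : u ∈ (ρ : Finset V)
    · simp [hu, vertexSign_erase_self]
    · have h : ¬(u ∉ (ρ : Finset V).erase u ∧ insert u ((ρ : Finset V).erase u) = ρ) :=
        fun h => hu (h.2 ▸ mem_insert_self _ _)
      rw [if_neg hu, if_neg h, zero_mul]
  · intro σ _ hσ
    rw [if_neg fun h => hσ (by rw [← h.2, erase_insert h.1]), zero_mul]
  · simp

theorem laplacian_form (X : AbstractSimplicialComplex V) (k : ℕ)
    (x : facesOfCard X (k + 1) → ℝ) :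
    x ⬝ᵥ (laplacian X k *ᵥ x) =
      ((boundary X (k + 1))ᵀ *ᵥ x) ⬝ᵥ ((boundary X (k + 1))ᵀ *ᵥ x) +
        (boundary X k *ᵥ x) ⬝ᵥ (boundary X k *ᵥ x) := by
  rw [laplacian, Matrix.add_mulVec, dotProduct_add, ← Matrix.mulVec_mulVec,
    ← Matrix.mulVec_mulVec, Matrix.dotProduct_mulVec x (boundary X (k + 1)),
    ← Matrix.mulVec_transpose (boundary X (k + 1)), Matrix.dotProduct_mulVec x (boundary X k)ᵀ,
    Matrix.vecMul_transpose]

theorem isFace_of_extendZero_ne_zero {X : AbstractSimplicialComplex V} {m : ℕ}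
    {x : facesOfCard X m → ℝ} {σ : Finset V} (h : extendZero _ x σ ≠ 0) :
    IsFace X σ ∧ #σ = m := by
  by_contra hσ
  exact h (extendZero_apply_notMem x fun h' => hσ (mem_facesOfCard.1 h'))

/-- Removing a vertex from a face leaves a face, so the sum extends to all sets with no correction.
-/
theorem lower_form (X : AbstractSimplicialComplex V) (k : ℕ) (x : facesOfCard X (k + 1) → ℝ) :
    (boundary X k *ᵥ x) ⬝ᵥ (boundary X k *ᵥ x) =
      ∑ u, ∑ v, annihilation u (extendZero _ x) ⬝ᵥ annihilation v (extendZero _ x) := by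
  have h1 : (boundary X k *ᵥ x) ⬝ᵥ (boundary X k *ᵥ x) =
      ∑ ρ : facesOfCard X k, (∑ u, annihilation u (extendZero _ x) (ρ : Finset V)) *
        ∑ v, annihilation v (extendZero _ x) (ρ : Finset V) :=
    sum_congr rfl fun ρ _ => by rw [boundary_mulVec_apply]
  rw [h1, sum_coe_sort (facesOfCard X k) fun ρ => (∑ u, annihilation u (extendZero _ x) ρ) *
    ∑ v, annihilation v (extendZero _ x) ρ, sum_subset (subset_univ _) fun ρ _ hρ => ?_]
  · simp only [sum_mul_sum, dotProduct]
    rw [sum_comm]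
    exact sum_congr rfl fun u _ => sum_comm
  · rw [sum_eq_zero fun u _ => ?_, zero_mul]
    by_contra h
    rw [annihilation_apply] at h
    split_ifs at h with hu
    · exact h rfl
    · obtain ⟨hf, hc⟩ := isFace_of_extendZero_ne_zero (right_ne_zero_of_mul h)
      rw [card_insert_of_notMem hu] at hc
      exact hρ (mem_facesOfCard.2 ⟨hf.mono (subset_insert _ _), by omega⟩)

open scoped Classical in
-- Adding a vertex may leave the complex, so unlike in `lower_form` the indicator of faces must
-- stay.
theorem upper_form (X : AbstractSimplicialComplex V) (k : ℕ) (x : facesOfCard X k → ℝ) :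
    ((boundary X k)ᵀ *ᵥ x) ⬝ᵥ ((boundary X k)ᵀ *ᵥ x) =
      ∑ u, ∑ v, ∑ ρ, (if IsFace X ρ then 1 else 0) *
        (creation u (extendZero _ x) ρ * creation v (extendZero _ x) ρ) := by
  have h1 : ((boundary X k)ᵀ *ᵥ x) ⬝ᵥ ((boundary X k)ᵀ *ᵥ x) =
      ∑ ρ : facesOfCard X (k + 1), (if IsFace X (ρ : Finset V) then 1 else 0) *
        ((∑ u, creation u (extendZero _ x) (ρ : Finset V)) *
          ∑ v, creation v (extendZero _ x) (ρ : Finset V)) :=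
    sum_congr rfl fun ρ _ => by
      rw [boundary_transpose_mulVec_apply, if_pos (mem_facesOfCard.1 ρ.2).1, one_mul]
  rw [h1, sum_coe_sort (facesOfCard X (k + 1)) fun ρ => (if IsFace X ρ then 1 else 0) *
    ((∑ u, creation u (extendZero _ x) ρ) * ∑ v, creation v (extendZero _ x) ρ),
    sum_subset (subset_univ _) fun ρ _ hρ => ?_]
  · simp only [sum_mul_sum]
    simp only [mul_sum]
    rw [sum_comm]
    exact sum_congr rfl fun u _ => sum_comm
  · by_cases hf : IsFace X ρ
    · rw [sum_eq_zero fun u _ => ?_, zero_mul, mul_zero]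
      by_contra h
      rw [creation_apply] at h
      split_ifs at h with hu
      · obtain ⟨-, hc⟩ := isFace_of_extendZero_ne_zero (right_ne_zero_of_mul h)
        exact hρ (mem_facesOfCard.2 ⟨hf, by rw [← hc, card_erase_add_one hu]⟩)
      · exact h rfl
    · rw [if_neg hf, zero_mul]

/-- The maximum in the bound on the eigenvalues of the Laplacian. -/
def maxDefect (X : AbstractSimplicialComplex V) (k : ℕ) : ℕ :=
  (facesOfCard X (k + 1)).sup fun σ => ∑ j ∈ range (k + 2), (j + 1) * #(defect X σ j)

theorem derivation_form_add_le (X : AbstractSimplicialComplex V) (k : ℕ)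
    (x : facesOfCard X (k + 1) → ℝ) :
    extendZero _ x ⬝ᵥ derivation (graphLaplacianAddJ X) (extendZero _ x) +
        -(k * Fintype.card V + maxDefect X k) * (x ⬝ᵥ x) ≤
      x ⬝ᵥ (laplacian X k *ᵥ x) := by
  classical
  set f := extendZero _ x with hf
  have h1 := form_ge (X := X) (f := f) fun σ h => (isFace_of_extendZero_ne_zero h).1
  have h2 : -(k * Fintype.card V + maxDefect X k) * (x ⬝ᵥ x) ≤
      ∑ σ, (∑ v, ((if v ∉ σ ∧ IsFace X (insert v σ) then (1 : ℝ) else 0) -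
        (#{u ∈ σ | (graph X).Adj u v} + #{u ∈ σ | IsBad X u v (σ.erase u)} : ℕ))) * f σ ^ 2 := by
    rw [← extendZero_dotProduct_self, ← hf, dotProduct, mul_sum]
    refine sum_le_sum fun σ _ => ?_
    by_cases hσ : f σ = 0
    · simp [hσ]
    obtain ⟨hface, hcard⟩ := isFace_of_extendZero_ne_zero hσ
    rw [← sq]
    refine mul_le_mul_of_nonneg_right ?_ (sq_nonneg _)
    have h3 := sum_card_adj_add_card_isBad_le X hcard
    have h4 : ∑ j ∈ range (k + 2), (j + 1) * #(defect X σ j) ≤ maxDefect X k :=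
      le_sup (f := fun σ => ∑ j ∈ range (k + 2), (j + 1) * #(defect X σ j))
        (mem_facesOfCard.2 ⟨hface, hcard⟩)
    have h5 := (Nat.cast_le (α := ℝ)).2 (h3.trans (Nat.add_le_add_left h4 _))
    rw [sum_sub_distrib]
    push_cast at h5 ⊢
    linarith
  -- The second sum, from the entries `1` of `J`, is the lower form itself; only the first needs an
  -- estimate.
  have h6 : f ⬝ᵥ derivation (graphLaplacianAddJ X) f =
      ∑ u, ∑ v, (graph X).lapMatrix ℝ u v * (annihilation u f ⬝ᵥ annihilation v f) +
        ∑ u, ∑ v, annihilation u f ⬝ᵥ annihilation v f := by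
    rw [dotProduct_derivation, ← sum_add_distrib]
    refine sum_congr rfl fun u _ => ?_
    rw [← sum_add_distrib]
    refine sum_congr rfl fun v _ => ?_
    rw [graphLaplacianAddJ, Matrix.add_apply, Matrix.of_apply, add_mul, one_mul]
  rw [laplacian_form, upper_form, lower_form, ← hf, h6]
  simp only [sum_sub_distrib] at h1
  simp only [sum_sub_distrib] at h2
  linarith

theorem isHermitian_graphLaplacianAddJ (X : AbstractSimplicialComplex V) :
    (graphLaplacianAddJ X).IsHermitian := by
  classical
  refine Matrix.IsHermitian.add ?_ (by ext; simp)
  rw [Matrix.IsHermitian, Matrix.conjTranspose_eq_transpose_of_trivial]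
  exact SimpleGraph.isSymm_lapMatrix ℝ (graph X)

theorem isHermitian_laplacian (X : AbstractSimplicialComplex V) (k : ℕ) :
    (laplacian X k).IsHermitian := by
  rw [Matrix.IsHermitian, Matrix.conjTranspose_eq_transpose_of_trivial, laplacian]
  simp [Matrix.transpose_mul]

end Comparison

end SimplicialLaplacian

end

/-! ### The eigenvalue bound -/

open SimplicialLaplacian

theorem theorem1p5 {V : Type*} [Fintype V] [LinearOrder V] (n : ℕ) (hn : Fintype.card V = n)
    (X : AbstractSimplicialComplex V) (k i : ℕ) (hi : 1 ≤ i) (hik : i ≤ #(facesOfCard X (k + 1))) :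
    eig (laplacian X k) i ≥
      eigSum (graphLaplacianAddJ X) (k + 1) i - (k : ℝ) * n
        - (((facesOfCard X (k + 1)).sup fun σ =>
            ∑ j ∈ Finset.range (k + 2), (j + 1) * #(defect X σ j) : ℕ) : ℝ) := by
  have hL := isHermitian_laplacian X k
  obtain ⟨u, hu, hMu⟩ := exists_enumerated_eigenvectors hn (isHermitian_graphLaplacianAddJ X)
  obtain ⟨v, hv, hLv⟩ := exists_orthonormal_eigenvectors hL
  have hcard : Fintype.card (Fin n) = Fintype.card V := by rw [Fintype.card_fin, hn]
  obtain ⟨w, hw, hwsupp, hform⟩ := exists_eigenbasis_derivation hcard hu hMu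
  -- Keeps `i` within the number of subset sums, so that `nthSmallest` does not return its default
  -- `0`.
  have hsub : #(facesOfCard X (k + 1)) ≤ #((univ : Finset (Fin n)).powersetCard (k + 1)) := by
    rw [card_powersetCard, card_univ, hcard, ← card_univ, ← card_powersetCard]
    exact card_le_card fun σ hσ =>
      mem_powersetCard.2 ⟨subset_univ _, (mem_facesOfCard.1 hσ).2⟩
  have key := nthSmallest_add_le_nthSmallest rfl
    (by rw [Fintype.card_finset, Fintype.card_finset, hcard]) hv hw
    (extendZero (facesOfCard X (k + 1))) (extendZero_dotProduct_self _)
    ((univ : Finset (Fin n)).powersetCard (k + 1))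
    -- An eigenvector `w A` lives on sets of size `#A`, so cochains on `X(k)` only meet those with
    -- `#A = k + 1`.
    (fun A hA x => sum_eq_zero fun σ _ => by
      by_cases hσ : #σ = #A
      · rw [extendZero_apply_notMem, mul_zero]
        exact fun h => hA (mem_powersetCard.2
          ⟨subset_univ _, hσ.symm.trans (mem_facesOfCard.1 h).2⟩)
      · rw [hwsupp A σ hσ, zero_mul])
    hL.eigenvalues _ (-(k * Fintype.card V + maxDefect X k))
    (fun x => by
      rw [← hform, ← dotProduct_mulVec_eq_sum hL hv hLv]
      exact derivation_form_add_le X k x)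
    hi (by rwa [Fintype.card_coe]) (hik.trans hsub)
  rw [← eigSum_eq_nthSmallest hn, ← roots_charpoly_eq_map_eigenvalues hL, hn] at key
  change _ ≤ eig (laplacian X k) i at key
  change _ - (maxDefect X k : ℝ) ≤ _
  linarith
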